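/- **Setting.** Let $n\ge 1$, $d\ge 0$, and let $p\in\mathbb R[x_1,\dots,x_n]$ have degree at most $2d$. For $\alpha\in\mathbb N^n$ with $|\alpha|\le 2d$ let $m_\alpha=\binom{2d}{2d-|\alpha|,\alpha_1,\dots,\alpha_n}^{-1}\operatorname{coeff}(p,x^\alpha)$ and let $M_d=[m_{\beta+\beta'}]_{|\beta|,|\beta'|\le d}$. For a vector $v=(v_0,\dots,v_n)$ put $L_v=v_0+v_1x_1+\cdots+v_nx_n$. A *Gramian decomposition* of $p$ of length $s$ is an identity $p=\sum_{t=1}^s\lambda_tL_{v_t}^{2d}$ with distinct $v_t\in\mathbb R^{n+1}$ and $\lambda_t>0$; the *Gramian rank* of $p$ is the least such $s$. A *symmetric decomposition* is defined in the same way with distinct $v_t\in\mathbb C^{n+1}$ and $\lambda_t\in\mathbb C\setminus\{0\}$; the least length is the *symmetric rank*. The *rank $r$ symmetric decomposition of $p$ is unique* if $p$ has symmetric rank $r$ and, for any two symmetric decompositions $(\lambda_t,v_t)_{t\le r}$, $(\mu_t,w_t)_{t\le r}$ of $p$ of length $r$, there are a permutation $\sigma$ and nonzero $c_t\in\mathbb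 C$ with $w_t=c_tv_{\sigma(t)}$ and $\mu_tc_t^{2d}=\lambda_{\sigma(t)}$ for all $t$. Let $N=\binom{n+d+1}{n}$ be the number of monomials of degree at most $d+1$, index $N\times N$ matrices by these monomials, and let $\mathcal S_N$ be the space of real symmetric $N\times N$ matrices, with $\langle A,B\rangle=\operatorname{Tr}(AB)$. Let $\mathcal P$ be the set of positive semidefinite $X\in\mathcal S_N$ such that $X_{\beta,\beta'}=m_{\beta+\beta'}$ whenever $|\beta+\beta'|\le 2d$ and $X_{\beta,\beta'}=X_{\gamma,\gamma'}$ whenever $\beta+\beta'=\gamma+\gamma'$; let $\mathcal P^*$ be the set of those $X\in\mathcal P$ at which $\operatorname{trace}(X)$ is minimal over $\mathcal P$ (the optimal solutions of the relaxation). For $|\alpha|\le 2d+2$ let $\mathcal S_\alpha\subset\mathcal S_N$ be the subspace of matrices whose entries vanish outside the positions $(\gamma,\delta)$ with $\gamma+\delta=\alpha$, let $Y_\alpha\in\mathcal S_\alpha$ be the matrix with entry $1$ at all these positions, and let $\{Z_{\alpha,i}:1\le i\le\dim\mathcal S_\alpha-1\}$ be an arbitrary orthonormal basis of the orthogonal complement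 of $Y_\alpha$ in $\mathcal S_\alpha$. Let $p=\sum_{t=1}^r\lambda_t(1+z_{t,1}x_1+\cdots+z_{t,n}x_n)^{2d}$ be a Gramian decomposition of $p$, with distinct points $z_t\in\mathbb R^n$ and $\lambda_t>0$, and let $M_{d+1}=V_{d+1}^T\Lambda V_{d+1}$, where $V_{d+1}=[z_t^\beta]_{1\le t\le r,\ |\beta|\le d+1}$ and $\Lambda=\operatorname{diag}(\lambda_1,\dots,\lambda_r)$. **Proposition.** Assume that $p$ has Gramian rank $r$, that the rank $r$ symmetric decomposition of $p$ is unique, and that $\operatorname{rank}M_d=r$. If there exists $S\in\mathcal S_N$ of rank $N-r$ such that $S\succeq 0$, $M_{d+1}S=0$ and $$S=I-\sum_{|\alpha|\le 2d}y_\alpha Y_\alpha-\sum_{|\alpha|\le 2d+2}\ \sum_{i=1}^{\dim\mathcal S_\alpha-1}z_{\alpha,i}Z_{\alpha,i}$$ for some real numbers $y_\alpha$, $z_{\alpha,i}$, then $\mathcal P^*=\{M_{d+1}\}$. -/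

import Mathlib

open MvPolynomial

noncomputable section

/-! ### Monomials and moments -/

/-- Exponents of the monomials of degree at most `k` in `n` variables. -/
abbrev Mon (n k : ℕ) : Type := {α : Fin n →₀ ℕ // α.degree ≤ k}

instance instFintypeMon (n k : ℕ) : Fintype (Mon n k) :=
  @Fintype.ofFinite _ (Finsupp.finite_of_degree_le (σ := Fin n) k).to_subtype

/-- Homogenizing exponents, `Mon n k` is the set of `(n+1)`-tuples of naturals with sum `k`. -/
def monEquiv (n k : ℕ) : Mon n k ≃ {P : Fin (n + 1) → ℕ // ∑ i, P i = k} where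
  toFun α := ⟨Fin.cons (k - α.1.degree) (fun i => α.1 i), by
    have h := α.2
    rw [Fin.sum_univ_succ]
    simp only [Fin.cons_zero, Fin.cons_succ]
    rw [← Finsupp.degree_eq_sum]
    omega⟩
  invFun P := ⟨Finsupp.equivFunOnFinite.symm (fun i => P.1 i.succ), by
    have h := P.2
    rw [Fin.sum_univ_succ] at h
    rw [Finsupp.degree_eq_sum]
    simp only [Finsupp.equivFunOnFinite_symm_apply_apply]
    omega⟩
  left_inv α := by
    ext i
    simp
  right_inv P := by
    have h := P.2
    rw [Fin.sum_univ_succ] at h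
    ext i
    refine Fin.cases ?_ (fun j => ?_) i
    · simp only [Fin.cons_zero, Finsupp.degree_eq_sum,
        Finsupp.equivFunOnFinite_symm_apply_apply]
      omega
    · simp

/-- The number of monomials of degree at most `k` in `n` variables is `binom(n+k, n)`. -/
theorem card_mon (n k : ℕ) : Fintype.card (Mon n k) = (n + k).choose n := by
  rw [Fintype.card_congr ((monEquiv n k).trans (Sym.equivNatSumOfFintype (Fin (n + 1)) k).symm),
    Sym.card_sym_eq_choose, Fintype.card_fin, show n + 1 + k - 1 = n + k by omega,
    ← Nat.choose_symm_add]

/-- The multinomial coefficient `D! / ((D - |α|)! α₁! ⋯ αₙ!)` (used for `|α| ≤ D`). -/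
def multinomialCoeff {n : ℕ} (D : ℕ) (α : Fin n →₀ ℕ) : ℕ :=
  Nat.multinomial Finset.univ (Fin.cons (D - α.degree) (fun i => α i) : Fin (n + 1) → ℕ)

/-- The moments `m_α = coeff_α(p) / multinomial(D; α)` of a polynomial `p` of degree at most `D`. -/
def moment {n : ℕ} (D : ℕ) (p : MvPolynomial (Fin n) ℝ) (α : Fin n →₀ ℕ) : ℝ :=
  coeff α p / (multinomialCoeff D α : ℝ)

/-- The truncated moment matrix `M_d` of a polynomial `p` of degree at most `2 d`. -/
def truncatedMomentMatrix {n : ℕ} (d : ℕ) (p : MvPolynomial (Fin n) ℝ) :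
    Matrix (Mon n d) (Mon n d) ℝ :=
  Matrix.of fun β β' => moment (2 * d) p (β.1 + β'.1)

/-! ### Symmetric and Gramian decompositions -/

/-- The affine-linear form `L_v = v₀ + v₁ x₁ + ⋯ + vₙ xₙ`. -/
def linForm {K : Type*} [Field K] {n : ℕ} (v : Fin (n + 1) → K) : MvPolynomial (Fin n) K :=
  C (v 0) + ∑ j : Fin n, C (v j.succ) * X j

/-- `p = ∑ₜ λₜ L_{vₜ}^D` with distinct vectors `vₜ` and nonzero coefficients `λₜ`. -/
def IsSymmetricDecomposition {K : Type*} [Field K] {n s : ℕ} (D : ℕ)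
    (p : MvPolynomial (Fin n) K) (lam : Fin s → K) (v : Fin s → Fin (n + 1) → K) : Prop :=
  Function.Injective v ∧ (∀ t, lam t ≠ 0) ∧ p = ∑ t, C (lam t) * linForm (v t) ^ D

/-- `p = ∑ₜ λₜ L_{vₜ}^D` with distinct real vectors `vₜ` and positive coefficients `λₜ`. -/
def IsGramianDecomposition {n s : ℕ} (D : ℕ)
    (p : MvPolynomial (Fin n) ℝ) (lam : Fin s → ℝ) (v : Fin s → Fin (n + 1) → ℝ) : Prop :=
  Function.Injective v ∧ (∀ t, 0 < lam t) ∧ p = ∑ t, C (lam t) * linForm (v t) ^ D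

/-- `p` has Gramian rank `r`: `r` is the least length of a Gramian decomposition of `p`. -/
def HasGramianRank {n : ℕ} (D : ℕ) (p : MvPolynomial (Fin n) ℝ) (r : ℕ) : Prop :=
  IsLeast {s : ℕ | ∃ (lam : Fin s → ℝ) (v : Fin s → Fin (n + 1) → ℝ),
    IsGramianDecomposition D p lam v} r

/-- A real polynomial viewed over the algebraic closure `ℂ` of `ℝ`. -/
def complexify {n : ℕ} (p : MvPolynomial (Fin n) ℝ) : MvPolynomial (Fin n) ℂ :=
  MvPolynomial.map (algebraMap ℝ ℂ) p

/-- `p` has (symmetric) rank `r`: `r` is the least length of a symmetric decomposition of `p`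
over the algebraic closure. -/
def HasSymmetricRank {n : ℕ} (D : ℕ) (p : MvPolynomial (Fin n) ℝ) (r : ℕ) : Prop :=
  IsLeast {s : ℕ | ∃ (lam : Fin s → ℂ) (v : Fin s → Fin (n + 1) → ℂ),
    IsSymmetricDecomposition D (complexify p) lam v} r

/-- `p` has rank `r` and its rank `r` symmetric decomposition is essentially unique: any two
decompositions agree up to a permutation of the terms and a rescaling of each vector `vₜ`
that is compensated for by `λₜ`. -/
def HasUniqueSymmetricDecomposition {n : ℕ} (D : ℕ) (p : MvPolynomial (Fin n) ℝ) (r : ℕ) : Prop :=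
  HasSymmetricRank D p r ∧
  ∀ (lam mu : Fin r → ℂ) (v w : Fin r → Fin (n + 1) → ℂ),
    IsSymmetricDecomposition D (complexify p) lam v →
    IsSymmetricDecomposition D (complexify p) mu w →
    ∃ (σ : Equiv.Perm (Fin r)) (c : Fin r → ℂ), ∀ t,
      c t ≠ 0 ∧ w t = c t • v (σ t) ∧ mu t * c t ^ D = lam (σ t)

/-- The vector `(1, z₁, …, zₙ)`. -/
def affinePoint {n : ℕ} (z : Fin n → ℝ) : Fin (n + 1) → ℝ :=
  Fin.cons 1 z

/-- The Vandermonde matrix `V_k = [z_i^β]`, with one row per point and one column per monomial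
of degree at most `k`. -/
def vandermondeMatrix {n r : ℕ} (k : ℕ) (z : Fin r → Fin n → ℝ) : Matrix (Fin r) (Mon n k) ℝ :=
  Matrix.of fun i β => ∏ j, z i j ^ (β.1 j)

/-- The moment matrix `M_k = V_kᵀ Λ V_k` with weights `λ` at the points `z`. -/
def momentMatrixOfPoints {n r : ℕ} (k : ℕ) (lam : Fin r → ℝ) (z : Fin r → Fin n → ℝ) :
    Matrix (Mon n k) (Mon n k) ℝ :=
  (vandermondeMatrix k z).transpose * Matrix.diagonal lam * vandermondeMatrix k z

/-! ### The relaxation -/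

/-- The entries depend only on the product of the indexing monomials. -/
def IsMomentMatrix {n k : ℕ} (X : Matrix (Mon n k) (Mon n k) ℝ) : Prop :=
  ∀ β β' γ γ' : Mon n k, β.1 + β'.1 = γ.1 + γ'.1 → X β β' = X γ γ'

/-- Positive semidefinite moment matrices of degree `d + 1` with the moments of `p` up to
degree `2 d`. -/
def feasibleSet {n : ℕ} (d : ℕ) (p : MvPolynomial (Fin n) ℝ) :
    Set (Matrix (Mon n (d + 1)) (Mon n (d + 1)) ℝ) :=
  {X | (∀ β β' : Mon n (d + 1), (β.1 + β'.1).degree ≤ 2 * d →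
          X β β' = moment (2 * d) p (β.1 + β'.1)) ∧
       IsMomentMatrix X ∧ X.PosSemidef}

/-- The feasible matrices of minimal trace. -/
def optimalSet {n : ℕ} (d : ℕ) (p : MvPolynomial (Fin n) ℝ) :
    Set (Matrix (Mon n (d + 1)) (Mon n (d + 1)) ℝ) :=
  {X | X ∈ feasibleSet d p ∧ ∀ X' ∈ feasibleSet d p, X.trace ≤ X'.trace}

/-! ### Certificates -/

/-- The symmetric matrices supported on the pairs `(γ, δ)` with `γ + δ = α`. -/
def symSupported {n : ℕ} (k : ℕ) (α : Fin n →₀ ℕ) :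
    Submodule ℝ (Matrix (Mon n k) (Mon n k) ℝ) where
  carrier := {A | A.IsSymm ∧ ∀ γ δ : Mon n k, γ.1 + δ.1 ≠ α → A γ δ = 0}
  zero_mem' := ⟨Matrix.isSymm_zero, fun _ _ _ => rfl⟩
  add_mem' := fun hA hB => ⟨hA.1.add hB.1, fun γ δ h => by
    simp [hA.2 γ δ h, hB.2 γ δ h]⟩
  smul_mem' := fun c _ hA => ⟨hA.1.smul c, fun γ δ h => by
    simp [hA.2 γ δ h]⟩

/-- The moment matrix `Y_α` with entry `1` at all pairs `(γ, δ)` with `γ + δ = α`. -/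
def Ymat {n : ℕ} (k : ℕ) (α : Fin n →₀ ℕ) : Matrix (Mon n k) (Mon n k) ℝ :=
  Matrix.of fun γ δ => if γ.1 + δ.1 = α then 1 else 0

/-- A family of `dim S_α - 1` matrices for every monomial of degree at most `2 k`. -/
abbrev ZFamily (n k : ℕ) : Type :=
  (α : Mon n (2 * k)) → Fin (Module.finrank ℝ (symSupported k α.1) - 1) →
    Matrix (Mon n k) (Mon n k) ℝ

/-- For every `α` the family `Z_α` is an orthonormal basis, for `⟨A, B⟩ = Tr (A B)`, of the
subspace of `S_α` orthogonal to `Y_α`. -/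
def IsOrthonormalChoice {n k : ℕ} (Z : ZFamily n k) : Prop :=
  ∀ α : Mon n (2 * k),
    (∀ i j, (Z α i * Z α j).trace = if i = j then 1 else 0) ∧
    ∀ A : Matrix (Mon n k) (Mon n k) ℝ,
      A ∈ Submodule.span ℝ (Set.range (Z α)) ↔
        A ∈ symSupported k α.1 ∧ (Ymat k α.1 * A).trace = 0

/-- `S ⪰ 0`, `M S = 0`, and
`S = I - ∑_{|α| ≤ 2d} y_α Y_α - ∑_{|α| ≤ 2d+2, i} z_{α,i} Z_{α,i}` for some reals `y`, `z`. -/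
def IsCertificate {n d : ℕ} (Z : ZFamily n (d + 1))
    (M S : Matrix (Mon n (d + 1)) (Mon n (d + 1)) ℝ) : Prop :=
  M * S = 0 ∧
  (∃ (y : Mon n (2 * d) → ℝ)
     (z : (α : Mon n (2 * (d + 1))) →
        Fin (Module.finrank ℝ (symSupported (d + 1) α.1) - 1) → ℝ),
     S = 1 - ∑ α, y α • Ymat (d + 1) α.1 - ∑ α, ∑ i, z α i • Z α i) ∧
  S.PosSemidef

end

/-! ### Moments of sums of powers of linear forms -/

/-! The certificate `S` is a dual solution. On feasible `X` the difference `X.trace - (S * X).trace`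
is constant: each `Y_α` with `|α| ≤ 2d` pairs with `X` to a number fixed by the moments of `p`, and
each `Z_{α,i}` is orthogonal to every moment matrix (`trace_sub_trace_certificate_mul`). Since `M =
M_{d+1}` is feasible and `S * M = 0`, the trace of `X` is `Tr M + Tr (S X) ≥ Tr M`, with equality
iff `S * X = 0`.

Uniqueness is a rank argument. The kernel of `S` has dimension `r` and contains the columns of
`V_{d+1}ᵀ`, hence is spanned by them, so an optimal `X` satisfies `X - M = V_{d+1}ᵀ B`
(`Matrix.exists_eq_mul_of_mul_eq_zero`). The block of `X - M` in degrees at most `d` is zero, and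
`V_dᵀ` is injective because `rank M_d = r`; by symmetry `X - M = 0`
(`Matrix.eq_zero_of_submatrix_eq_zero`). -/

theorem prod_cons_X_pow {n : ℕ} (v : Fin (n + 1) → ℝ) (k : Fin (n + 1) → ℕ) :
    ∏ i, (Fin.cons (C (v 0)) (fun j => C (v j.succ) * X j) :
        Fin (n + 1) → MvPolynomial (Fin n) ℝ) i ^ k i =
      monomial (Finsupp.equivFunOnFinite.symm fun j => k j.succ) (∏ i, v i ^ k i) := by
  rw [Fin.prod_univ_succ, Fin.prod_univ_succ, monomial_eq, Finsupp.prod_fintype _ _ (by simp)]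
  simp only [Fin.cons_zero, Fin.cons_succ, mul_pow, Finset.prod_mul_distrib, C_mul, C_pow,
    map_prod, Finsupp.equivFunOnFinite_symm_apply_apply]
  ring

/-- The coefficients of a power of a linear form. -/
theorem coeff_linForm_pow {n : ℕ} (D : ℕ) (v : Fin (n + 1) → ℝ) (α : Fin n →₀ ℕ)
    (hα : α.degree ≤ D) :
    coeff α (linForm v ^ D) =
      multinomialCoeff D α * (v 0 ^ (D - α.degree) * ∏ j, v j.succ ^ α j) := by
  have hlin : linForm v = ∑ i, (Fin.cons (C (v 0)) (fun j => C (v j.succ) * X j) :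
      Fin (n + 1) → MvPolynomial (Fin n) ℝ) i := by
    simp [Fin.sum_univ_succ, linForm]
  rw [hlin, Finset.sum_pow_eq_sum_piAntidiag, coeff_sum]
  simp only [prod_cons_X_pow, ← map_natCast (C : ℝ →+* MvPolynomial (Fin n) ℝ), coeff_C_mul,
    coeff_monomial]
  -- Only one exponent tuple contributes: `α` fixes all entries but the zeroth, which the total `D`
  -- then forces.
  rw [Finset.sum_eq_single (Fin.cons (D - α.degree) (fun i => α i))]
  · rw [if_pos (by ext j; simp), Fin.prod_univ_succ]
    simp [multinomialCoeff]
  · intro k hk hne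
    rw [if_neg, mul_zero]
    rintro rfl
    apply hne
    have hsum := (Finset.mem_piAntidiag.1 hk).1
    rw [Fin.sum_univ_succ] at hsum
    ext i
    refine Fin.cases ?_ (fun j => ?_) i
    · simp only [Fin.cons_zero, Finsupp.degree_eq_sum,
        Finsupp.equivFunOnFinite_symm_apply_apply]
      omega
    · simp
  · intro h
    exfalso
    apply h
    rw [Finset.mem_piAntidiag, Fin.sum_univ_succ]
    simp only [Fin.cons_zero, Fin.cons_succ, ← Finsupp.degree_eq_sum]
    exact ⟨by omega, by simp⟩

/-- The moments of a sum of powers of affine forms are the moments of the underlying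
weighted point masses. -/
theorem moment_eq_sum {n r D : ℕ} {p : MvPolynomial (Fin n) ℝ} {lam : Fin r → ℝ}
    {z : Fin r → Fin n → ℝ}
    (hp : p = ∑ t, C (lam t) * linForm (affinePoint (z t)) ^ D)
    {α : Fin n →₀ ℕ} (hα : α.degree ≤ D) :
    moment D p α = ∑ t, lam t * ∏ j, z t j ^ α j := by
  have hpos : (multinomialCoeff D α : ℝ) ≠ 0 :=
    Nat.cast_ne_zero.2 (Nat.multinomial_pos _ _).ne'
  rw [moment, div_eq_iff hpos, hp, coeff_sum, Finset.sum_mul]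
  refine Finset.sum_congr rfl fun t _ => ?_
  rw [coeff_C_mul, coeff_linForm_pow _ _ _ hα]
  simp only [affinePoint, Fin.cons_zero, Fin.cons_succ, one_pow, one_mul]
  ring

theorem momentMatrixOfPoints_apply {n r : ℕ} (k : ℕ) (lam : Fin r → ℝ) (z : Fin r → Fin n → ℝ)
    (β β' : Mon n k) :
    momentMatrixOfPoints k lam z β β' = ∑ t, lam t * ∏ j, z t j ^ (β.1 + β'.1) j := by
  rw [momentMatrixOfPoints, Matrix.mul_apply]
  simp only [Matrix.mul_diagonal, Matrix.transpose_apply, vandermondeMatrix, Matrix.of_apply,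
    Finsupp.add_apply, pow_add, Finset.prod_mul_distrib]
  exact Finset.sum_congr rfl fun t _ => by ring

theorem momentMatrixOfPoints_posSemidef {n r : ℕ} (k : ℕ) {lam : Fin r → ℝ}
    (hlam : ∀ t, 0 < lam t) (z : Fin r → Fin n → ℝ) :
    (momentMatrixOfPoints k lam z).PosSemidef := by
  have h := (Matrix.PosSemidef.diagonal fun t => (hlam t).le).conjTranspose_mul_mul_same
    (vandermondeMatrix k z)
  rwa [Matrix.conjTranspose_eq_transpose_of_trivial] at h

theorem momentMatrixOfPoints_mem_feasibleSet {n d r : ℕ} {p : MvPolynomial (Fin n) ℝ}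
    {lam : Fin r → ℝ} {z : Fin r → Fin n → ℝ}
    (hdec : IsGramianDecomposition (2 * d) p lam (fun t => affinePoint (z t))) :
    momentMatrixOfPoints (d + 1) lam z ∈ feasibleSet d p := by
  refine ⟨fun β β' h => ?_, fun β β' γ γ' h => ?_, momentMatrixOfPoints_posSemidef _ hdec.2.1 z⟩
  · rw [momentMatrixOfPoints_apply, moment_eq_sum hdec.2.2 h]
  · rw [momentMatrixOfPoints_apply, momentMatrixOfPoints_apply, h]

theorem truncatedMomentMatrix_eq {n d r : ℕ} {p : MvPolynomial (Fin n) ℝ}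
    {lam : Fin r → ℝ} {z : Fin r → Fin n → ℝ}
    (hp : p = ∑ t, C (lam t) * linForm (affinePoint (z t)) ^ (2 * d)) :
    truncatedMomentMatrix d p = momentMatrixOfPoints d lam z := by
  ext β β'
  have h : (β.1 + β'.1).degree ≤ 2 * d := by
    have := β.2
    have := β'.2
    rw [map_add]
    omega
  rw [momentMatrixOfPoints_apply, ← moment_eq_sum hp h]
  rfl

/-! ### Trace duality for positive semidefinite matrices -/

-- Writing `A = P* P` and `B = Q* Q`, the trace of `A B` is the squared Frobenius norm of `Q P*`.
open scoped MatrixOrder in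
theorem Matrix.PosSemidef.trace_mul_nonneg_and_eq_zero {ι : Type*} [Fintype ι]
    {A B : Matrix ι ι ℝ} (hA : A.PosSemidef) (hB : B.PosSemidef) :
    0 ≤ (A * B).trace ∧ ((A * B).trace = 0 → A * B = 0) := by
  classical
  obtain ⟨P, hP⟩ := CStarAlgebra.nonneg_iff_eq_star_mul_self.mp hA.nonneg
  obtain ⟨Q, hQ⟩ := CStarAlgebra.nonneg_iff_eq_star_mul_self.mp hB.nonneg
  rw [Matrix.star_eq_conjTranspose] at hP hQ
  have key : (A * B).trace =
      ((Q * P.conjTranspose).conjTranspose * (Q * P.conjTranspose)).trace := by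
    rw [hP, hQ, Matrix.conjTranspose_mul, Matrix.conjTranspose_conjTranspose, Matrix.mul_assoc,
      Matrix.trace_mul_comm]
    simp only [Matrix.mul_assoc]
  rw [key]
  refine ⟨(Matrix.posSemidef_conjTranspose_mul_self _).trace_nonneg, fun h => ?_⟩
  rw [Matrix.trace_conjTranspose_mul_self_eq_zero_iff] at h
  have h' : P * Q.conjTranspose = 0 := by
    simpa using congrArg Matrix.conjTranspose h
  rw [hP, hQ, Matrix.mul_assoc, ← Matrix.mul_assoc P, h']
  simp

/-! ### Optimality -/

theorem trace_Ymat_mul {n k : ℕ} (α : Fin n →₀ ℕ) (A : Matrix (Mon n k) (Mon n k) ℝ) :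
    (Ymat k α * A).trace = ∑ γ, ∑ δ, if γ.1 + δ.1 = α then A δ γ else 0 := by
  simp [Matrix.trace, Matrix.mul_apply, Ymat]

/-- A moment matrix is constant on the support of `S_α`, so its pairing with `A` is a multiple of
`⟨Y_α, A⟩`. -/
theorem trace_mul_eq_zero_of_isMomentMatrix {n k : ℕ} {X A : Matrix (Mon n k) (Mon n k) ℝ}
    (hX : IsMomentMatrix X) {α : Fin n →₀ ℕ} (hA : A ∈ symSupported k α)
    (hA0 : (Ymat k α * A).trace = 0) : (A * X).trace = 0 := by
  by_cases hex : ∃ γ δ : Mon n k, γ.1 + δ.1 = α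
  · obtain ⟨γ₀, δ₀, h₀⟩ := hex
    have : (A * X).trace = X γ₀ δ₀ * (Ymat k α * A).trace := by
      rw [trace_Ymat_mul, Matrix.trace_mul_comm, Finset.mul_sum]
      simp only [Matrix.trace, Matrix.diag, Matrix.mul_apply, Finset.mul_sum]
      refine Finset.sum_congr rfl fun γ _ => Finset.sum_congr rfl fun δ _ => ?_
      by_cases h : γ.1 + δ.1 = α
      · rw [if_pos h, hX γ δ γ₀ δ₀ (h.trans h₀.symm)]
      · rw [if_neg h, hA.2 δ γ (by rwa [add_comm]), mul_zero, mul_zero]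
    rw [this, hA0, mul_zero]
  · have : A = 0 := by
      ext γ δ
      exact hA.2 γ δ fun h => hex ⟨γ, δ, h⟩
    simp [this]

theorem trace_Ymat_mul_eq_of_mem_feasibleSet {n d : ℕ} {p : MvPolynomial (Fin n) ℝ}
    {X X' : Matrix (Mon n (d + 1)) (Mon n (d + 1)) ℝ}
    (hX : X ∈ feasibleSet d p) (hX' : X' ∈ feasibleSet d p) (α : Mon n (2 * d)) :
    (Ymat (d + 1) α.1 * X).trace = (Ymat (d + 1) α.1 * X').trace := by
  rw [trace_Ymat_mul, trace_Ymat_mul]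
  refine Finset.sum_congr rfl fun γ _ => Finset.sum_congr rfl fun δ _ => ?_
  split_ifs with h
  · have h' : (δ.1 + γ.1).degree ≤ 2 * d := by rw [add_comm, h]; exact α.2
    rw [hX.1 δ γ h', hX'.1 δ γ h']
  · rfl

/-- The trace and the pairing with a certificate differ by a constant on the feasible set. -/
theorem trace_sub_trace_certificate_mul {n d : ℕ} {p : MvPolynomial (Fin n) ℝ}
    {Z : ZFamily n (d + 1)} (hZ : IsOrthonormalChoice Z)
    {M S X X' : Matrix (Mon n (d + 1)) (Mon n (d + 1)) ℝ} (hS : IsCertificate Z M S)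
    (hX : X ∈ feasibleSet d p) (hX' : X' ∈ feasibleSet d p) :
    X.trace - (S * X).trace = X'.trace - (S * X').trace := by
  obtain ⟨-, ⟨y, z, rfl⟩, -⟩ := hS
  have hZ0 : ∀ W ∈ feasibleSet d p, ∀ α i, (Z α i * W).trace = 0 := fun W hW α i => by
    have h := ((hZ α).2 (Z α i)).1 (Submodule.subset_span ⟨i, rfl⟩)
    exact trace_mul_eq_zero_of_isMomentMatrix hW.2.1 h.1 h.2
  have expand : ∀ W ∈ feasibleSet d p,
      W.trace - ((1 - ∑ α, y α • Ymat (d + 1) α.1 - ∑ α, ∑ i, z α i • Z α i) * W).trace =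
        ∑ α, y α * (Ymat (d + 1) α.1 * W).trace := fun W hW => by
    simp [sub_mul, Finset.sum_mul, Matrix.trace_sub, Matrix.trace_sum, hZ0 W hW]
  rw [expand X hX, expand X' hX']
  simp only [trace_Ymat_mul_eq_of_mem_feasibleSet hX hX']

/-! ### Ranks -/

theorem Matrix.mulVec_injective_of_rank_eq {ι : Type*} [Fintype ι] {r : ℕ}
    {W : Matrix ι (Fin r) ℝ} (hW : W.rank = r) : Function.Injective W.mulVec := by
  have h := W.mulVecLin.finrank_range_add_finrank_ker
  have h' : Module.finrank ℝ (LinearMap.range W.mulVecLin) = r := hW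
  rw [h', Module.finrank_fin_fun, Nat.add_eq_left, Submodule.finrank_eq_zero] at h
  exact LinearMap.ker_eq_bot.1 h

/-- If `S W = 0` with `W` injective of rank complementary to `S`, then every matrix killed by `S`
factors through `W`. -/
theorem Matrix.exists_eq_mul_of_mul_eq_zero {ι κ : Type*} [Fintype ι] {r : ℕ}
    {S : Matrix ι ι ℝ} {W : Matrix ι (Fin r) ℝ} (hSW : S * W = 0)
    (hW : Function.Injective W.mulVec) (hrank : S.rank + r = Fintype.card ι)
    {D : Matrix ι κ ℝ} (hD : S * D = 0) : ∃ B : Matrix (Fin r) κ ℝ, D = W * B := by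
  have hle : LinearMap.range W.mulVecLin ≤ LinearMap.ker S.mulVecLin := by
    rintro _ ⟨x, rfl⟩
    simp [Matrix.mulVec_mulVec, hSW]
  have hfr : Module.finrank ℝ (LinearMap.range W.mulVecLin) = r := by
    rw [LinearMap.finrank_range_of_inj (f := W.mulVecLin) hW, Module.finrank_fin_fun]
  have hker := S.mulVecLin.finrank_range_add_finrank_ker
  rw [Module.finrank_fintype_fun_eq_card] at hker
  have hfk : Module.finrank ℝ (LinearMap.ker S.mulVecLin) = r := by
    have : S.rank = Module.finrank ℝ (LinearMap.range S.mulVecLin) := rfl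
    omega
  -- Both spaces have dimension `r`, so the inclusion `range W ≤ ker S` is an equality.
  have heq := Submodule.eq_of_le_of_finrank_eq hle (hfr.trans hfk.symm)
  have hcol : ∀ j, ∃ x, W.mulVec x = D.col j := fun j => by
    have : D.col j ∈ LinearMap.ker S.mulVecLin := by
      ext i
      exact congrFun (congrFun hD i) j
    rw [← heq] at this
    exact this
  choose x hx using hcol
  refine ⟨Matrix.of fun t j => x j t, ?_⟩
  ext i j
  exact (congrFun (hx j) i).symm

theorem Matrix.eq_zero_of_mul_eq_zero_of_mulVec_injective {ι κ μ : Type*} [Fintype κ]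
    {W : Matrix ι κ ℝ} (hW : Function.Injective W.mulVec) {B : Matrix κ μ ℝ}
    (h : W * B = 0) : B = 0 := by
  ext t j
  have : W.mulVec (B.col j) = W.mulVec 0 := by
    rw [Matrix.mulVec_zero]
    ext i
    exact congrFun (congrFun h i) j
  exact congrFun (hW this) t

/-- A symmetric matrix factoring through `W` vanishes as soon as one of its principal blocks, on
whose rows `W` is injective, vanishes. -/
theorem Matrix.eq_zero_of_submatrix_eq_zero {ι ι' κ : Type*} [Fintype κ]
    {D : Matrix ι ι ℝ} (hD : D.IsSymm) {W : Matrix ι κ ℝ} {B : Matrix κ ι ℝ} (hB : D = W * B)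
    (e : ι' → ι) (hW : Function.Injective (W.submatrix e id).mulVec)
    (h0 : D.submatrix e e = 0) : D = 0 := by
  -- Injectivity on the block kills the columns of `B` in `e`, hence those of `D`; by symmetry the
  -- rows of `D` in `e` vanish too, and injectivity applied once more gives `B = 0`.
  have hBe : B.submatrix id e = 0 := by
    apply Matrix.eq_zero_of_mul_eq_zero_of_mulVec_injective hW
    rw [← h0, hB]
    rfl
  have hcol : ∀ i j, D i (e j) = 0 := fun i j => by
    rw [hB, Matrix.mul_apply]
    exact Finset.sum_eq_zero fun t _ => by
      rw [show B t (e j) = 0 from congrFun (congrFun hBe t) j, mul_zero]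
  have hB0 : B = 0 := by
    apply Matrix.eq_zero_of_mul_eq_zero_of_mulVec_injective hW
    ext i j
    have : (W.submatrix e id * B) i j = D (e i) j := by rw [hB]; rfl
    rw [this, ← hD.apply, hcol]
    rfl
  rw [hB, hB0, Matrix.mul_zero]

/-- `V_dᵀ` is a left factor of `M_d` and has only `r` columns, so its rank is squeezed to `r`. -/
theorem vandermondeMatrix_transpose_mulVec_injective {n d r : ℕ} {lam : Fin r → ℝ}
    {z : Fin r → Fin n → ℝ} (h : (momentMatrixOfPoints d lam z).rank = r) :
    Function.Injective (vandermondeMatrix d z).transpose.mulVec := by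
  apply Matrix.mulVec_injective_of_rank_eq
  apply le_antisymm
  · exact (vandermondeMatrix d z).transpose.rank_le_card_width.trans_eq (Fintype.card_fin r)
  · rw [momentMatrixOfPoints, Matrix.mul_assoc] at h
    calc r = _ := h.symm
      _ ≤ _ := Matrix.rank_mul_le_left _ _

/-- Inclusion of the monomials of degree at most `k` into those of degree at most `k + 1`. -/
def Mon.succ {n k : ℕ} (β : Mon n k) : Mon n (k + 1) := ⟨β.1, β.2.trans k.le_succ⟩

theorem Matrix.mulVec_injective_of_submatrix {ι ι' κ : Type*} [Fintype κ] {W : Matrix ι κ ℝ}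
    (e : ι' → ι) (hW : Function.Injective (W.submatrix e id).mulVec) :
    Function.Injective W.mulVec := fun _ _ hxy =>
  hW <| funext fun i => congrFun hxy (e i)

/-- In `Vᵀ Λ V S = 0` the injective `Vᵀ` and the positive diagonal `Λ` cancel; transposing `V S = 0`
gives the claim. -/
theorem certificate_mul_vandermondeMatrix_transpose {n k r : ℕ} {lam : Fin r → ℝ}
    (hlam : ∀ t, 0 < lam t) {z : Fin r → Fin n → ℝ}
    (hinj : Function.Injective (vandermondeMatrix k z).transpose.mulVec)
    {S : Matrix (Mon n k) (Mon n k) ℝ} (hS : S.IsSymm)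
    (hMS : momentMatrixOfPoints k lam z * S = 0) :
    S * (vandermondeMatrix k z).transpose = 0 := by
  rw [momentMatrixOfPoints, Matrix.mul_assoc, Matrix.mul_assoc] at hMS
  have h := Matrix.eq_zero_of_mul_eq_zero_of_mulVec_injective hinj hMS
  have hVS : vandermondeMatrix k z * S = 0 := by
    ext t j
    have ht := congrFun (congrFun h t) j
    rw [Matrix.diagonal_mul] at ht
    exact (mul_eq_zero.1 ht).resolve_left (hlam t).ne'
  rw [← hS.eq, ← Matrix.transpose_mul, hVS, Matrix.transpose_zero]

theorem mainTheorem6 (n d r : ℕ) (hn : 1 ≤ n)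
    (p : MvPolynomial (Fin n) ℝ) (hp : p.totalDegree ≤ 2 * d)
    (lam : Fin r → ℝ) (z : Fin r → Fin n → ℝ)
    (hdec : IsGramianDecomposition (2 * d) p lam (fun t => affinePoint (z t)))
    (hgram : HasGramianRank (2 * d) p r)
    (huniq : HasUniqueSymmetricDecomposition (2 * d) p r)
    (hflat : (truncatedMomentMatrix d p).rank = r)
    (Z : ZFamily n (d + 1)) (hZ : IsOrthonormalChoice Z)
    (S : Matrix (Mon n (d + 1)) (Mon n (d + 1)) ℝ)
    (hS : IsCertificate Z (momentMatrixOfPoints (d + 1) lam z) S)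
    (hrank : S.rank + r = (n + d + 1).choose n) :
    optimalSet d p = {momentMatrixOfPoints (d + 1) lam z} := by
  set M := momentMatrixOfPoints (d + 1) lam z with hM
  have hMf : M ∈ feasibleSet d p := momentMatrixOfPoints_mem_feasibleSet hdec
  have hSsymm : S.IsSymm := by
    have h : S.conjTranspose = S := hS.2.2.isHermitian
    rwa [Matrix.conjTranspose_eq_transpose_of_trivial] at h
  have hMsymm : M.IsSymm := by
    have h : M.conjTranspose = M := hMf.2.2.isHermitian
    rwa [Matrix.conjTranspose_eq_transpose_of_trivial] at h
  have hSM : S * M = 0 := by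
    rw [← hSsymm.eq, ← hMsymm.eq, ← Matrix.transpose_mul, hS.1, Matrix.transpose_zero]
  have htr : ∀ X ∈ feasibleSet d p, X.trace = M.trace + (S * X).trace := fun X hX => by
    have h := trace_sub_trace_certificate_mul hZ hS hX hMf
    rw [hSM, Matrix.trace_zero] at h
    linarith
  rw [truncatedMomentMatrix_eq hdec.2.2] at hflat
  have hinj := vandermondeMatrix_transpose_mulVec_injective hflat
  -- The rows of `V_{d+1}ᵀ` in degrees at most `d` form `V_dᵀ` by definition.
  have hinj' : Function.Injective
      ((vandermondeMatrix (d + 1) z).transpose.submatrix Mon.succ id).mulVec := hinj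
  ext X
  rw [Set.mem_singleton_iff]
  constructor
  · rintro ⟨hX, hmin⟩
    have hpair := hS.2.2.trace_mul_nonneg_and_eq_zero hX.2.2
    -- Minimality against the feasible `M` gives `Tr (S X) ≤ 0`.
    have hSX : S * X = 0 := hpair.2 (le_antisymm (by linarith [htr X hX, hmin M hMf]) hpair.1)
    have hXsymm : X.IsSymm := by
      have h : X.conjTranspose = X := hX.2.2.isHermitian
      rwa [Matrix.conjTranspose_eq_transpose_of_trivial] at h
    have hinj1 := Matrix.mulVec_injective_of_submatrix _ hinj'
    obtain ⟨B, hB⟩ := Matrix.exists_eq_mul_of_mul_eq_zero (D := X - M)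
      (certificate_mul_vandermondeMatrix_transpose hdec.2.1 hinj1 hSsymm hS.1) hinj1
      (by rw [hrank, card_mon, add_assoc]) (by rw [Matrix.mul_sub, hSX, hSM, sub_zero])
    refine sub_eq_zero.1 (Matrix.eq_zero_of_submatrix_eq_zero (hXsymm.sub hMsymm) hB
      Mon.succ hinj' ?_)
    -- Two indices of degree at most `d` give a moment of degree at most `2d`, prescribed by `p` in
    -- both matrices.
    ext β β'
    have h : (β.succ.1 + β'.succ.1).degree ≤ 2 * d := by
      have := β.2
      have := β'.2
      change (β.1 + β'.1).degree ≤ 2 * d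
      rw [map_add]
      omega
    simp [hX.1 _ _ h, hMf.1 _ _ h]
  · rintro rfl
    refine ⟨hMf, fun X hX => ?_⟩
    linarith [htr X hX, (hS.2.2.trace_mul_nonneg_and_eq_zero hX.2.2).1]
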